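/- Let $d\ge 1$, let $\Omega\subset\mathbb{R}^d$ be open and bounded, and let $A\subset\mathbb{R}^d$ be a set with $C^1$ boundary in a neighborhood of $\overline\Omega$. That is, there is an open set $U\supset\overline\Omega$ such that every $p\in\partial A\cap U$ has an open neighborhood $V$ and a $C^1$ function $\varphi:V\to\mathbb{R}$ with $\nabla\varphi\neq 0$ on $V$, $\partial A\cap V=\{\varphi=0\}$ and $\{\varphi<0\}\subset A\cap V\subset\{\varphi\le 0\}$ (so $\partial A$ is a $C^1$ hypersurface and $A$ lies locally on one side of it). Suppose further that $\mathcal{H}^{d-1}(\partial A\cap\partial\Omega)=0$. Then for every (arbitrary) set $M\subset\Omega$, $$\limsup_{r\downarrow 0}\ \mathcal{H}^{d-1}\Big(\big(\{x:\operatorname{dist}(x,A)=r\}\cap\Omega\big)\setminus\{x:\operatorname{dist}(x,M)<3r\}\Big)\ \le\ \mathcal{H}^{d-1}\big((\partial A\cap\Omega)\setminus M\big),$$ where $\mathcal{H}^{d-1}$ is the $(d-1)$-dimensional Hausdorff (outer) measure and $\operatorname{dist}(x,\emptyset)=+\infty$. -/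

import Mathlib

/-- The set `A` has `C¹` boundary in the set `U`: near each point of `∂A ∩ U`, the boundary `∂A` is
the regular zero set `{φ = 0}` of a real `C¹` function `φ` (i.e. an embedded `C¹` hypersurface
without boundary), and `A` lies locally on exactly one side of it, namely
`{φ < 0} ⊆ A ⊆ {φ ≤ 0}` in the neighbourhood `V`. -/
def HasC1BoundaryIn {d : ℕ} (A U : Set (EuclideanSpace ℝ (Fin d))) : Prop :=
  ∀ p ∈ frontier A ∩ U, ∃ (V : Set (EuclideanSpace ℝ (Fin d))) (φ : EuclideanSpace ℝ (Fin d) → ℝ),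
    IsOpen V ∧ p ∈ V ∧ ContDiffOn ℝ 1 φ V ∧ (∀ x ∈ V, fderiv ℝ φ x ≠ 0) ∧
    (∀ x ∈ V, x ∈ frontier A ↔ φ x = 0) ∧
    (∀ x ∈ V, φ x < 0 → x ∈ A) ∧ (∀ x ∈ V, 0 < φ x → x ∉ A)

/- Near a boundary point a `C¹` set satisfies, for every `ε > 0`, a cone condition: all nearby
points seen from a point of its closure within a cone of opening almost `π` around `-n` are
interior. Hence the boundary and the level sets `{dist(·, A) = r}` are both `ε`-Lipschitz graphs
over `nᗮ`, and the projection to `nᗮ` distorts their surface measure by a factor close to one.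
Moreover each point at distance `r` from `A` lies above a boundary point less than `c * r` away,
for any fixed `c > 1`; this boundary point is not in `M` if the distance to `M` is at least `c * r`.
So, locally, the limit superior of the level measures on `C` is at most the boundary measure of
`closure C`, which is that of `C` when `∂C` is null. Compactness of `closure Ω` and cutting along
spheres that are null in `∂A` give the global bound. -/

open MeasureTheory Set Metric Filter Topology Module
open scoped InnerProductSpace ENNReal NNReal

section Topology

theorem limsup_add_le_add_limsup {ι : Type*} {l : Filter ι} (u v : ι → ℝ≥0∞) :
    limsup (fun i => u i + v i) l ≤ limsup u l + limsup v l := by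
  refine ENNReal.le_of_forall_pos_le_add fun ε hε hfin => ?_
  have hε' : (ε / 2 : ℝ≥0∞) ≠ 0 := by simpa using hε.ne'
  obtain ⟨hu, hv⟩ := ENNReal.add_lt_top.1 hfin
  refine limsup_le_of_le (by isBoundedDefault) ?_
  filter_upwards [eventually_lt_of_limsup_lt (ENNReal.lt_add_right hu.ne hε'),
    eventually_lt_of_limsup_lt (ENNReal.lt_add_right hv.ne hε')] with i hui hvi
  calc u i + v i ≤ (limsup u l + ε / 2) + (limsup v l + ε / 2) := add_le_add hui.le hvi.le
    _ = limsup u l + limsup v l + ε := by rw [add_add_add_comm, ENNReal.add_halves]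

variable {X : Type*} [TopologicalSpace X]

theorem inter_frontier_nonempty_of_isPreconnected {s A : Set X} (hs : IsPreconnected s)
    (hA : (s ∩ A).Nonempty) (hAc : (s \ A).Nonempty) : (s ∩ frontier A).Nonempty := by
  by_contra hempty
  have hfr : ∀ z ∈ s, z ∉ frontier A := fun z hz hzA => hempty ⟨z, hz, hzA⟩
  obtain ⟨a, has, haA⟩ := hA
  obtain ⟨b, hbs, hbA⟩ := hAc
  have hcover : s ⊆ interior A ∪ (closure A)ᶜ := fun z hz => by
    by_cases hzA : z ∈ closure A
    · exact Or.inl (by_contra fun hzi => hfr z hz ⟨hzA, hzi⟩)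
    · exact Or.inr hzA
  obtain ⟨z, -, hzi, hzc⟩ := hs _ _ isOpen_interior isClosed_closure.isOpen_compl hcover
    ⟨a, has, (hcover has).resolve_right (not_not.2 (subset_closure haA))⟩
    ⟨b, hbs, (hcover hbs).resolve_left fun hb => hbA (interior_subset hb)⟩
  exact hzc (subset_closure (interior_subset hzi))

variable [MeasurableSpace X]

theorem measure_frontier_inter_eq_zero {σ : Measure X} {s t : Set X} (hs : σ (frontier s) = 0)
    (ht : σ (frontier t) = 0) : σ (frontier (s ∩ t)) = 0 :=
  measure_mono_null ((frontier_inter_subset s t).trans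
    (union_subset_union inter_subset_left inter_subset_right)) (measure_union_null hs ht)

theorem limsup_measure_inter_le_of_isCompact [OpensMeasurableSpace X] {ι : Type*} {l : Filter ι}
    {L : ι → Set X} {μ ν σ : Measure X} {Q : Set X} (hQ : IsCompact Q)
    (hloc : ∀ p ∈ Q, ∃ O, IsOpen O ∧ p ∈ O ∧ σ (frontier O) = 0 ∧ ∀ C ⊆ O, σ (frontier C) = 0 →
      limsup (fun i => μ (L i ∩ C)) l ≤ ν C) :
    ∀ C ⊆ Q, σ (frontier C) = 0 → limsup (fun i => μ (L i ∩ C)) l ≤ ν C := by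
  suffices ∃ O, IsOpen O ∧ Q ⊆ O ∧ σ (frontier O) = 0 ∧ ∀ C ⊆ O, σ (frontier C) = 0 →
      limsup (fun i => μ (L i ∩ C)) l ≤ ν C by
    obtain ⟨O, -, hQO, -, hO⟩ := this
    exact fun C hC => hO C (hC.trans hQO)
  refine hQ.induction_on ?_ ?_ ?_ ?_
  · refine ⟨∅, isOpen_empty, Subset.rfl, by simp, fun C hC _ => ?_⟩
    exact limsup_le_of_le (by isBoundedDefault) (by simp [subset_empty_iff.1 hC])
  · rintro s t hst ⟨O, hOo, htO, hO⟩
    exact ⟨O, hOo, hst.trans htO, hO⟩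
  · rintro s t ⟨O, hOo, hsO, hOnull, hO⟩ ⟨O', hOo', htO', hOnull', hO'⟩
    refine ⟨O ∪ O', hOo.union hOo', union_subset_union hsO htO', ?_, fun C hC hCnull => ?_⟩
    · rw [← frontier_compl, compl_union]
      exact measure_frontier_inter_eq_zero (by rwa [frontier_compl]) (by rwa [frontier_compl])
    have hin := hO (C ∩ O) inter_subset_right (measure_frontier_inter_eq_zero hCnull hOnull)
    have hout := hO' (C \ O) (fun x hx => (hC hx.1).resolve_left hx.2)
      (measure_frontier_inter_eq_zero hCnull ((frontier_compl O).symm ▸ hOnull))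
    calc limsup (fun i => μ (L i ∩ C)) l
        ≤ limsup (fun i => μ (L i ∩ (C ∩ O)) + μ (L i ∩ (C \ O))) l := by
          refine limsup_le_limsup (.of_forall fun i => ?_)
          simpa only [inter_assoc, inter_sdiff_assoc] using
            measure_le_inter_add_sdiff μ (L i ∩ C) O
      _ ≤ limsup (fun i => μ (L i ∩ (C ∩ O))) l + limsup (fun i => μ (L i ∩ (C \ O))) l :=
          limsup_add_le_add_limsup _ _
      _ ≤ ν (C ∩ O) + ν (C \ O) := add_le_add hin hout
      _ = ν C := measure_inter_add_sdiff C hOo.measurableSet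
  · intro p hp
    obtain ⟨O, hOo, hpO, hO⟩ := hloc p hp
    exact ⟨O, mem_nhdsWithin_of_mem_nhds (hOo.mem_nhds hpO), O, hOo, Subset.rfl, hO⟩

end Topology

section Metric

theorem tendsto_const_mul_nhdsGT_zero (c : ℝ) : Tendsto (fun r : ℝ => c * r) (𝓝[>] 0) (𝓝 0) := by
  have hcont : Tendsto (fun r : ℝ => c * r) (𝓝 0) (𝓝 (c * 0)) := Continuous.tendsto (by fun_prop) 0
  rw [mul_zero] at hcont
  exact hcont.mono_left nhdsWithin_le_nhds

theorem limsup_measure_inter_le_of_cthickening {X : Type*} [PseudoEMetricSpace X]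
    [MeasurableSpace X] [OpensMeasurableSpace X] {μ ν : Measure X} {L : ℝ → Set X} {C : Set X}
    {c : ℝ} (hfin : ∃ R > 0, ν (cthickening R C) ≠ ∞) (hnull : ν (frontier C) = 0)
    (hle : ∀ᶠ r in 𝓝[>] 0, μ (L r ∩ C) ≤ ν (cthickening (c * r) C)) :
    limsup (fun r => μ (L r ∩ C)) (𝓝[>] 0) ≤ ν C := by
  have hlim : Tendsto (fun r : ℝ => ν (cthickening (c * r) C)) (𝓝[>] 0) (𝓝 (ν (closure C))) :=
    (tendsto_measure_cthickening hfin).comp (tendsto_const_mul_nhdsGT_zero c)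
  calc limsup (fun r => μ (L r ∩ C)) (𝓝[>] 0)
      ≤ limsup (fun r => ν (cthickening (c * r) C)) (𝓝[>] 0) := limsup_le_limsup hle
    _ = ν (closure C) := hlim.limsup_eq
    _ = ν C := measure_closure_of_null_frontier hnull

theorem exists_measure_frontier_ball_eq_zero {X : Type*} [PseudoMetricSpace X] [MeasurableSpace X]
    [OpensMeasurableSpace X] {μ : Measure X} {p : X} {R : ℝ} (hR : 0 < R)
    (hfin : μ (ball p R) < ∞) : ∃ s ∈ Ioo 0 R, μ (frontier (ball p s)) = 0 := by
  have : IsFiniteMeasure (μ.restrict (ball p R)) := ⟨by rwa [Measure.restrict_apply_univ]⟩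
  obtain ⟨s, hs, hnull⟩ := exists_null_frontier_thickening (μ.restrict (ball p R)) {p} hR
  rw [thickening_singleton, Measure.restrict_apply isClosed_frontier.measurableSet] at hnull
  refine ⟨s, hs, measure_mono_null (subset_inter Subset.rfl ?_) hnull⟩
  exact frontier_ball_subset_sphere.trans (sphere_subset_ball hs.2)

theorem exists_mem_closure_dist_eq {X : Type*} [PseudoMetricSpace X] [ProperSpace X] {A : Set X}
    {x : X} {r : ℝ} (hr : 0 ≤ r) (hx : infEDist x A = ENNReal.ofReal r) :
    ∃ a ∈ closure A, dist x a = r := by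
  have hne : A.Nonempty := by
    rw [nonempty_iff_ne_empty]
    rintro rfl
    simp at hx
  obtain ⟨a, ha, hxa⟩ := exists_mem_closure_infDist_eq_dist hne x
  exact ⟨a, ha, by rw [← hxa, infDist, hx, ENNReal.toReal_ofReal hr]⟩

theorem infEDist_lt_edist_of_mem_interior {E : Type*} [SeminormedAddCommGroup E] [NormedSpace ℝ E]
    {A : Set E} {x b : E} (hb : b ∈ interior A) (hxb : 0 < dist x b) :
    infEDist x A < edist x b := by
  have hlim : Tendsto (fun t : ℝ => AffineMap.lineMap b x t) (𝓝[>] 0) (𝓝 b) := by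
    have hcont : Continuous fun t : ℝ => AffineMap.lineMap b x t := AffineMap.lineMap_continuous
    simpa only [AffineMap.lineMap_apply_zero] using (hcont.tendsto 0).mono_left nhdsWithin_le_nhds
  obtain ⟨t, htA, ht0, ht1⟩ := ((hlim.eventually (mem_interior_iff_mem_nhds.1 hb)).and
    (Ioo_mem_nhdsGT one_pos)).exists
  refine (infEDist_le_edist_of_mem htA).trans_lt ?_
  rw [edist_dist, edist_dist, ENNReal.ofReal_lt_ofReal_iff hxb, dist_comm x, dist_lineMap_right,
    Real.norm_of_nonneg (by linarith), dist_comm b]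
  nlinarith

/-- The points at distance exactly `r` from `A` and at distance at least `c * r` from `M`. The
distances are extended, so that nothing is at distance `r` from `∅`, and everything is far
from `∅`. -/
def farLevelSet {X : Type*} [PseudoEMetricSpace X] (A M : Set X) (c r : ℝ) : Set X :=
  {x | infEDist x A = ENNReal.ofReal r} \ {x | infEDist x M < ENNReal.ofReal (c * r)}

end Metric

section Projection

theorem hausdorffMeasure_le_of_antilipschitzWith_domRestrict {X Y : Type*} [EMetricSpace X]
    [EMetricSpace Y] [MeasurableSpace X] [BorelSpace X] [MeasurableSpace Y] [BorelSpace Y]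
    {f : X → Y} {s : Set X} {K : ℝ≥0} (hf : AntilipschitzWith K (s.domRestrict f)) {q : ℝ}
    (hq : 0 ≤ q) : μH[q] s ≤ (K : ℝ≥0∞) ^ q * μH[q] (f '' s) := by
  have hle := hf.le_hausdorffMeasure_image hq univ
  rwa [← isometry_subtype_coe.hausdorffMeasure_image (Or.inl hq), image_univ, Subtype.range_coe,
    image_univ, range_domRestrict] at hle

variable {E : Type*} [NormedAddCommGroup E] [InnerProductSpace ℝ E]

theorem norm_orthogonalProjectionOnto_span_singleton {n : E} (hn : ‖n‖ = 1) (v : E) :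
    ‖(ℝ ∙ n).orthogonalProjectionOnto v‖ = |⟪n, v⟫_ℝ| := by
  rw [← Submodule.norm_coe, ← Submodule.starProjection_apply,
    Submodule.starProjection_unit_singleton ℝ hn, norm_smul, hn, mul_one, Real.norm_eq_abs]

theorem norm_le_mul_norm_orthogonalProjectionOnto {n v : E} (hn : ‖n‖ = 1) {ε : ℝ} {K : ℝ≥0}
    (hK : 1 ≤ (K : ℝ) ^ 2 * (1 - ε ^ 2)) (hv : |⟪n, v⟫_ℝ| ≤ ε * ‖v‖) :
    ‖v‖ ≤ K * ‖(ℝ ∙ n)ᗮ.orthogonalProjectionOnto v‖ := by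
  have hpyth := Submodule.norm_sq_eq_add_norm_sq_projection v (ℝ ∙ n)
  rw [norm_orthogonalProjectionOnto_span_singleton hn] at hpyth
  have hsq : |⟪n, v⟫_ℝ| ^ 2 ≤ (ε * ‖v‖) ^ 2 := pow_le_pow_left₀ (abs_nonneg _) hv 2
  refine le_of_sq_le_sq ?_ (by positivity)
  nlinarith [sq_nonneg ‖v‖, sq_nonneg (K : ℝ)]

variable [MeasurableSpace E] [BorelSpace E]

theorem hausdorffMeasure_le_image_orthogonalProjectionOnto {n : E} (hn : ‖n‖ = 1) {ε : ℝ} {K : ℝ≥0}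
    (hK : 1 ≤ (K : ℝ) ^ 2 * (1 - ε ^ 2)) {s : Set E}
    (hs : ∀ x ∈ s, ∀ y ∈ s, ⟪n, x - y⟫_ℝ ≤ ε * ‖x - y‖) {q : ℝ} (hq : 0 ≤ q) :
    μH[q] s ≤ (K : ℝ≥0∞) ^ q * μH[q] ((ℝ ∙ n)ᗮ.orthogonalProjectionOnto '' s) := by
  refine hausdorffMeasure_le_of_antilipschitzWith_domRestrict
    (AntilipschitzWith.of_le_mul_dist fun x y => ?_) hq
  rw [Subtype.dist_eq, dist_eq_norm, dist_eq_norm, domRestrict_apply, domRestrict_apply, ← map_sub]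
  refine norm_le_mul_norm_orthogonalProjectionOnto hn hK (abs_le'.2 ⟨hs x x.2 y y.2, ?_⟩)
  rw [← inner_neg_right, neg_sub, norm_sub_rev]
  exact hs y y.2 x x.2

theorem hausdorffMeasure_image_orthogonalProjectionOnto_le (S : Submodule ℝ E)
    [S.HasOrthogonalProjection] (s : Set E) {q : ℝ} (hq : 0 ≤ q) :
    μH[q] (S.orthogonalProjectionOnto '' s) ≤ μH[q] s := by
  simpa using (Submodule.lipschitzWith_orthogonalProjectionOnto S).hausdorffMeasure_image_le hq s

theorem hausdorffMeasure_orthogonal_span_singleton_lt_top [FiniteDimensional ℝ E] {n : E}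
    (hn : n ≠ 0) {s : Set (ℝ ∙ n)ᗮ} (hs : Bornology.IsBounded s) :
    μH[finrank ℝ E - 1] s < ∞ := by
  have hrank : (finrank ℝ E - 1 : ℝ) = finrank ℝ (ℝ ∙ n)ᗮ := by
    rw [← Submodule.finrank_add_finrank_orthogonal (ℝ ∙ n), finrank_span_singleton hn]
    push_cast
    ring
  have := isAddHaarMeasure_hausdorffMeasure (E := (ℝ ∙ n)ᗮ)
  rw [hrank]
  exact hs.measure_lt_top

end Projection

section OuterNormal

variable {E : Type*} [NormedAddCommGroup E] [InnerProductSpace ℝ E]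

/-- The cone condition: inside `B`, every point seen from a point `x` of `closure A` in a direction
whose angle with `-n` has cosine larger than `ε` is interior to `A`. -/
structure IsApproxOuterNormalOn (A B : Set E) (ε : ℝ) (n : E) : Prop where
  norm_eq_one : ‖n‖ = 1
  mem_interior : ∀ x ∈ closure A ∩ B, ∀ y ∈ B, ε * ‖x - y‖ < ⟪n, x - y⟫_ℝ → y ∈ interior A

/-- Regularity of the boundary in the form in which it is used: near `p` the cone condition holds
with every precision `ε > 0`. The direction `n` is allowed to depend on `ε`. -/
def HasFlatBoundaryAt (A : Set E) (p : E) : Prop :=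
  ∀ ε > 0, ∃ B ∈ 𝓝 p, ∃ n, IsApproxOuterNormalOn A B ε n

theorem hasFlatBoundaryAt_of_notMem_frontier [Nontrivial E] {A : Set E} {p : E}
    (hp : p ∉ frontier A) : HasFlatBoundaryAt A p := by
  intro ε _
  obtain ⟨n, hn⟩ := exists_norm_eq E zero_le_one
  by_cases hpA : p ∈ closure A
  · exact ⟨interior A, isOpen_interior.mem_nhds (by_contra fun hpi => hp ⟨hpA, hpi⟩), n, hn,
      fun _ _ _ hy _ => hy⟩
  · exact ⟨(closure A)ᶜ, isClosed_closure.isOpen_compl.mem_nhds hpA, n, hn,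
      fun _ hx => (hx.2 hx.1).elim⟩

theorem hasFlatBoundaryAt_of_hasStrictFDerivAt [CompleteSpace E] {A : Set E} {p : E} {φ : E → ℝ}
    {φ' : E →L[ℝ] ℝ} (hφ : HasStrictFDerivAt φ φ' p) (hφ' : φ' ≠ 0)
    (hneg : ∀ᶠ x in 𝓝 p, φ x < 0 → x ∈ A) (hpos : ∀ᶠ x in 𝓝 p, 0 < φ x → x ∉ A) :
    HasFlatBoundaryAt A p := by
  intro ε hε
  set g : E := (InnerProductSpace.toDual ℝ E).symm φ'
  have hg : 0 < ‖g‖ := by simpa [g] using hφ'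
  have hφg : ∀ v, φ' v = ⟪g, v⟫_ℝ := fun v => InnerProductSpace.toDual_symm_apply.symm
  obtain ⟨B₀, hB₀, happrox⟩ := hφ.approximates_deriv_on_nhds
    (c := .mk (ε * ‖g‖) (by positivity)) (Or.inr (mul_pos hε hg))
  obtain ⟨B, hB, hBo, hpB⟩ := _root_.mem_nhds_iff.1 (inter_mem hB₀ (inter_mem hneg hpos))
  have hcont : ContinuousOn φ B := happrox.continuousOn.mono fun x hx => (hB hx).1
  have hclosure : ∀ x ∈ closure A ∩ B, φ x ≤ 0 := by
    rintro x ⟨hxA, hxB⟩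
    by_contra! hx
    obtain ⟨y, ⟨hyB, hy⟩, hyA⟩ := _root_.mem_closure_iff.1 hxA _
      (hcont.isOpen_inter_preimage hBo isOpen_Ioi) ⟨hxB, hx⟩
    exact (hB hyB).2.2 hy hyA
  have hinterior : ∀ y ∈ B, φ y < 0 → y ∈ interior A := fun y hyB hy =>
    interior_maximal (fun z hz => (hB hz.1).2.1 hz.2) (hcont.isOpen_inter_preimage hBo isOpen_Iio)
      ⟨hyB, hy⟩
  refine ⟨B, hBo.mem_nhds hpB, ‖g‖⁻¹ • g, ?_, fun x hx y hy hcone => hinterior y hy ?_⟩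
  · rw [norm_smul, norm_inv, norm_norm, inv_mul_cancel₀ hg.ne']
  · rw [real_inner_smul_left, lt_inv_mul_iff₀ hg] at hcone
    have hxy := happrox x (hB hx.2).1 y (hB hy).1
    rw [hφg, Real.norm_eq_abs, NNReal.coe_mk] at hxy
    linarith [(abs_le.1 hxy).1, hclosure x hx]

namespace IsApproxOuterNormalOn

variable {A B : Set E} {ε : ℝ} {n : E}

theorem mono (h : IsApproxOuterNormalOn A B ε n) {B' : Set E} (hB : B' ⊆ B) :
    IsApproxOuterNormalOn A B' ε n :=
  ⟨h.norm_eq_one, fun x hx y hy => h.mem_interior x ⟨hx.1, hB hx.2⟩ y (hB hy)⟩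

theorem inner_sub_le_of_mem_frontier (h : IsApproxOuterNormalOn A B ε n) {x y : E}
    (hx : x ∈ frontier A ∩ B) (hy : y ∈ frontier A ∩ B) : ⟪n, x - y⟫_ℝ ≤ ε * ‖x - y‖ :=
  not_lt.1 fun hlt => hy.1.2 (h.mem_interior x ⟨hx.1.1, hx.2⟩ y hy.2 hlt)

variable [ProperSpace E]

theorem inner_sub_le_of_infEDist_eq (h : IsApproxOuterNormalOn A B ε n) {r : ℝ} (hr : 0 < r)
    {x y : E} (hxB : closedBall x r ⊆ B) (hyB : closedBall y r ⊆ B)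
    (hx : infEDist x A = ENNReal.ofReal r) (hy : infEDist y A = ENNReal.ofReal r) :
    ⟪n, x - y⟫_ℝ ≤ ε * ‖x - y‖ := by
  obtain ⟨a, haA, hxa⟩ := exists_mem_closure_dist_eq hr.le hx
  -- translate the nearest point of `x`: it would be interior to `A` at distance `r` from `y`
  set b : E := a - (x - y)
  have hyb : dist y b = r := by
    rw [← hxa, dist_eq_norm, dist_eq_norm]
    congr 1
    simp only [b]
    abel
  have hab : a - b = x - y := sub_sub_cancel a (x - y)
  by_contra! hlt
  have hb : b ∈ interior A :=
    h.mem_interior a ⟨haA, hxB (mem_closedBall'.2 hxa.le)⟩ b (hyB (mem_closedBall'.2 hyb.le))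
      (by rwa [hab])
  have hlt := infEDist_lt_edist_of_mem_interior hb (hyb ▸ hr)
  rw [hy, edist_dist, hyb] at hlt
  exact lt_irrefl _ hlt

theorem sub_smul_mem_interior (h : IsApproxOuterNormalOn A B ε n) (hε : 0 ≤ ε) {c r : ℝ}
    (hc : 1 ≤ c) (hεc : ε * (c + 1) < c - 1) (hr : 0 < r) {x : E} (hxB : closedBall x (c * r) ⊆ B)
    (hx : infEDist x A = ENNReal.ofReal r) : x - (c * r) • n ∈ interior A := by
  obtain ⟨a, haA, hxa⟩ := exists_mem_closure_dist_eq hr.le hx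
  have hcr : 0 ≤ c * r := by positivity
  have hnorm : ‖(c * r) • n‖ = c * r := by
    rw [norm_smul, h.norm_eq_one, mul_one, Real.norm_of_nonneg hcr]
  have hsub : a - (x - (c * r) • n) = (c * r) • n - (x - a) := by abel
  rw [dist_eq_norm] at hxa
  have haB : a ∈ B := hxB (mem_closedBall'.2 (by rw [dist_eq_norm, hxa]; nlinarith))
  have hyB : x - (c * r) • n ∈ B := hxB (mem_closedBall'.2 (by simp [hnorm]))
  refine h.mem_interior a ⟨haA, haB⟩ _ hyB ?_
  calc ε * ‖a - (x - (c * r) • n)‖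
      ≤ ε * (c * r + r) := by
        rw [hsub]
        gcongr
        exact (norm_sub_le _ _).trans_eq (by rw [hnorm, hxa])
    _ < c * r - r := by nlinarith
    _ ≤ c * r - ⟪n, x - a⟫_ℝ := by
        gcongr
        exact (real_inner_le_norm n (x - a)).trans_eq (by rw [h.norm_eq_one, one_mul, hxa])
    _ = ⟪n, a - (x - (c * r) • n)⟫_ℝ := by
        rw [hsub, inner_sub_right n ((c * r) • n), real_inner_smul_right,
          real_inner_self_eq_norm_sq, h.norm_eq_one, one_pow, mul_one]

theorem exists_sub_smul_mem_frontier (h : IsApproxOuterNormalOn A B ε n) (hε : 0 ≤ ε) {c r : ℝ}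
    (hc : 1 ≤ c) (hεc : ε * (c + 1) < c - 1) (hr : 0 < r) {x : E} (hxB : closedBall x (c * r) ⊆ B)
    (hx : infEDist x A = ENNReal.ofReal r) : ∃ t ∈ Ico 0 (c * r), x - t • n ∈ frontier A := by
  have hend := h.sub_smul_mem_interior hε hc hεc hr hxB hx
  have hcr : 0 ≤ c * r := by positivity
  have hxA : x ∉ A := fun hxA => by
    rw [infEDist_zero_of_mem hxA, eq_comm, ENNReal.ofReal_eq_zero] at hx
    exact hx.not_gt hr
  have hpre : IsPreconnected ((fun t : ℝ => x - t • n) '' Icc 0 (c * r)) :=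
    isPreconnected_Icc.image _ (by fun_prop)
  obtain ⟨_, ⟨t, ht, rfl⟩, htA⟩ := inter_frontier_nonempty_of_isPreconnected hpre
    ⟨_, ⟨c * r, right_mem_Icc.2 hcr, rfl⟩, interior_subset hend⟩
    ⟨x, ⟨0, left_mem_Icc.2 hcr, by simp⟩, hxA⟩
  refine ⟨t, ⟨ht.1, ht.2.lt_of_ne ?_⟩, htA⟩
  rintro rfl
  exact htA.2 hend

variable [MeasurableSpace E] [BorelSpace E]

theorem hausdorffMeasure_farLevelSet_inter_le (h : IsApproxOuterNormalOn A B ε n) (hε : 0 ≤ ε)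
    {c r : ℝ} (hc : 1 ≤ c) (hεc : ε * (c + 1) < c - 1) {K : ℝ≥0}
    (hK : 1 ≤ (K : ℝ) ^ 2 * (1 - ε ^ 2)) (hr : 0 < r) {C : Set E} (hC : cthickening (c * r) C ⊆ B)
    (M : Set E) {q : ℝ} (hq : 0 ≤ q) :
    μH[q] (farLevelSet A M c r ∩ C) ≤
      (K : ℝ≥0∞) ^ q * μH[q] (cthickening (c * r) C ∩ (frontier A \ closure M)) := by
  have hball : ∀ x ∈ C, closedBall x (c * r) ⊆ B := fun x hx =>
    (closedBall_subset_cthickening hx _).trans hC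
  have hball' : ∀ x ∈ C, closedBall x r ⊆ B := fun x hx =>
    (closedBall_subset_closedBall (le_mul_of_one_le_left hr.le hc)).trans (hball x hx)
  refine (hausdorffMeasure_le_image_orthogonalProjectionOnto h.norm_eq_one hK (fun x hx y hy =>
    h.inner_sub_le_of_infEDist_eq hr (hball' x hx.2) (hball' y hy.2) hx.1.1 hy.1.1) hq).trans ?_
  gcongr
  refine (measure_mono ?_).trans (hausdorffMeasure_image_orthogonalProjectionOnto_le _ _ hq)
  rintro _ ⟨x, ⟨⟨hxA, hxM⟩, hxC⟩, rfl⟩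
  obtain ⟨t, ht, htA⟩ := h.exists_sub_smul_mem_frontier hε hc hεc hr (hball x hxC) hxA
  have hdist : dist x (x - t • n) = t := by
    rw [dist_eq_norm, sub_sub_cancel, norm_smul, h.norm_eq_one, mul_one, Real.norm_of_nonneg ht.1]
  refine ⟨x - t • n, ⟨?_, htA, fun htM => hxM ?_⟩, ?_⟩
  · exact closedBall_subset_cthickening hxC _ (mem_closedBall'.2 (hdist.trans_le ht.2.le))
  · rw [mem_ofPred_eq, ← infEDist_closure]
    refine (infEDist_le_edist_of_mem htM).trans_lt ?_
    rw [edist_dist, hdist, ENNReal.ofReal_lt_ofReal_iff (ht.1.trans_lt ht.2)]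
    exact ht.2
  · rw [map_sub, Submodule.orthogonalProjectionOnto_orthogonal_apply_eq_zero
      (Submodule.smul_mem _ t (Submodule.mem_span_singleton_self n)), sub_zero]

end IsApproxOuterNormalOn

end OuterNormal

section SurfaceMeasure

variable {E : Type*} [NormedAddCommGroup E] [InnerProductSpace ℝ E] [FiniteDimensional ℝ E]
  [Nontrivial E]

theorem finrank_sub_one_nonneg : (0 : ℝ) ≤ finrank ℝ E - 1 := by
  rw [sub_nonneg]
  exact_mod_cast Nat.one_le_iff_ne_zero.2 finrank_pos.ne'

variable [MeasurableSpace E] [BorelSpace E]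

theorem IsApproxOuterNormalOn.hausdorffMeasure_frontier_inter_lt_top
    {A B : Set E} {ε : ℝ} {n : E} (h : IsApproxOuterNormalOn A B ε n) {K : ℝ≥0}
    (hK : 1 ≤ (K : ℝ) ^ 2 * (1 - ε ^ 2)) (hB : Bornology.IsBounded B) :
    μH[finrank ℝ E - 1] (frontier A ∩ B) < ∞ := by
  have hn : n ≠ 0 := norm_pos_iff.1 (h.norm_eq_one ▸ one_pos)
  refine (hausdorffMeasure_le_image_orthogonalProjectionOnto h.norm_eq_one hK
    (fun x hx y hy => h.inner_sub_le_of_mem_frontier hx hy) finrank_sub_one_nonneg).trans_lt ?_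
  refine ENNReal.mul_lt_top
    (ENNReal.rpow_lt_top_of_nonneg finrank_sub_one_nonneg ENNReal.coe_ne_top) ?_
  exact hausdorffMeasure_orthogonal_span_singleton_lt_top hn
    ((Submodule.lipschitzWith_orthogonalProjectionOnto (ℝ ∙ n)ᗮ).isBounded_image
      (hB.subset inter_subset_right))

theorem exists_cone_precision {c : ℝ} (hc : 1 < c) {K : ℝ≥0} (hK : 1 < K) :
    ∃ ε > 0, ε * (c + 1) < c - 1 ∧ 1 ≤ (K : ℝ) ^ 2 * (1 - ε ^ 2) := by
  have hK' : (1 : ℝ) < K := by exact_mod_cast hK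
  have hcone : ∀ᶠ ε : ℝ in 𝓝 0, ε * (c + 1) < c - 1 :=
    ContinuousAt.eventually_lt (by fun_prop) continuousAt_const (by linarith)
  have hdistort : ∀ᶠ ε : ℝ in 𝓝 0, 1 < (K : ℝ) ^ 2 * (1 - ε ^ 2) :=
    ContinuousAt.eventually_lt continuousAt_const (by fun_prop) (by nlinarith [hK'])
  obtain ⟨ε, ⟨hε₁, hε₂⟩, hε⟩ := (((hcone.and hdistort).filter_mono nhdsWithin_le_nhds).and
    (self_mem_nhdsWithin : Ioi (0 : ℝ) ∈ 𝓝[>] 0)).exists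
  exact ⟨ε, hε, hε₁, hε₂.le⟩

theorem HasFlatBoundaryAt.exists_isOpen_limsup_farLevelSet_le {A : Set E} {p : E}
    (hp : HasFlatBoundaryAt A p) (M : Set E) {c : ℝ} (hc : 1 < c) {K : ℝ≥0} (hK : 1 < K) :
    ∃ O, IsOpen O ∧ p ∈ O ∧ μH[finrank ℝ E - 1].restrict (frontier A) (frontier O) = 0 ∧
      ∀ C ⊆ O, μH[finrank ℝ E - 1].restrict (frontier A) (frontier C) = 0 →
        limsup (fun r => μH[finrank ℝ E - 1] (farLevelSet A M c r ∩ C)) (𝓝[>] 0) ≤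
          ((K : ℝ≥0∞) ^ (finrank ℝ E - 1 : ℝ) •
            μH[finrank ℝ E - 1].restrict (frontier A \ closure M)) C := by
  set H : Measure E := μH[finrank ℝ E - 1]
  set κ : ℝ≥0∞ := (K : ℝ≥0∞) ^ (finrank ℝ E - 1 : ℝ)
  have hκ : κ ≠ ∞ :=
    (ENNReal.rpow_lt_top_of_nonneg finrank_sub_one_nonneg ENNReal.coe_ne_top).ne
  obtain ⟨ε, hε, hεc, hKε⟩ := exists_cone_precision hc hK
  obtain ⟨B, hB, n, hn⟩ := hp ε hε
  obtain ⟨ρ, hρ, hρB⟩ := Metric.mem_nhds_iff.1 hB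
  have hcone : IsApproxOuterNormalOn A (ball p ρ) ε n := hn.mono hρB
  have hfin : H.restrict (frontier A) (ball p ρ) < ∞ := by
    rw [Measure.restrict_apply isOpen_ball.measurableSet, inter_comm]
    exact hcone.hausdorffMeasure_frontier_inter_lt_top hKε isBounded_ball
  have hle : H.restrict (frontier A \ closure M) ≤ H.restrict (frontier A) :=
    Measure.restrict_mono_set H sdiff_subset
  obtain ⟨s, ⟨hs, hsρ⟩, hnull⟩ := exists_measure_frontier_ball_eq_zero (half_pos hρ)
    ((measure_mono (ball_subset_ball (half_le_self hρ.le))).trans_lt hfin)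
  refine ⟨ball p s, isOpen_ball, mem_ball_self hs, hnull, fun C hC hCnull => ?_⟩
  have hthick : cthickening (ρ / 2) C ⊆ ball p ρ := by
    refine (cthickening_subset_of_subset _ hC).trans ?_
    rw [cthickening_ball (half_pos hρ).le hs]
    exact closedBall_subset_ball (by linarith)
  refine limsup_measure_inter_le_of_cthickening (c := c) ⟨ρ / 2, half_pos hρ, ?_⟩ ?_ ?_
  · exact ENNReal.mul_ne_top hκ (((hle _).trans (measure_mono hthick)).trans_lt hfin).ne
  · simp [nonpos_iff_eq_zero.1 ((hle _).trans_eq hCnull)]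
  · filter_upwards [self_mem_nhdsWithin,
      tendsto_const_mul_nhdsGT_zero c (Iio_mem_nhds (half_pos hρ))] with r hr hrρ
    rw [Measure.smul_apply, Measure.restrict_apply isClosed_cthickening.measurableSet]
    exact hcone.hausdorffMeasure_farLevelSet_inter_le hε.le hc.le hεc hKε hr
      ((cthickening_mono (le_of_lt hrρ) C).trans hthick) M finrank_sub_one_nonneg

theorem limsup_farLevelSet_le_mul {A Ω : Set E} (hΩ : Bornology.IsBounded Ω)
    (hA : ∀ p ∈ frontier A ∩ closure Ω, HasFlatBoundaryAt A p)
    (hnull : μH[finrank ℝ E - 1] (frontier A ∩ frontier Ω) = 0) (M : Set E) {c : ℝ} (hc : 1 < c)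
    {K : ℝ≥0} (hK : 1 < K) :
    limsup (fun r => μH[finrank ℝ E - 1] (farLevelSet A M c r ∩ Ω)) (𝓝[>] 0) ≤
      (K : ℝ≥0∞) ^ (finrank ℝ E - 1 : ℝ) *
        μH[finrank ℝ E - 1] ((frontier A ∩ Ω) \ closure M) := by
  have hflat : ∀ p ∈ closure Ω, HasFlatBoundaryAt A p := fun p hp => by
    by_cases hpA : p ∈ frontier A
    · exact hA p ⟨hpA, hp⟩
    · exact hasFlatBoundaryAt_of_notMem_frontier hpA
  have hmeas : MeasurableSet (frontier A \ closure M) :=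
    isClosed_frontier.measurableSet.diff isClosed_closure.measurableSet
  refine (limsup_measure_inter_le_of_isCompact hΩ.isCompact_closure
    (fun p hp => (hflat p hp).exists_isOpen_limsup_farLevelSet_le M hc hK) Ω subset_closure
    ?_).trans_eq ?_
  · rwa [Measure.restrict_apply isClosed_frontier.measurableSet, inter_comm]
  · rw [Measure.smul_apply, Measure.restrict_apply' hmeas, smul_eq_mul, inter_comm,
      sdiff_inter_right_comm]

end SurfaceMeasure

theorem lemma6p2_general {E : Type*} [NormedAddCommGroup E] [InnerProductSpace ℝ E]
    [FiniteDimensional ℝ E] [Nontrivial E] [MeasurableSpace E] [BorelSpace E] {A Ω : Set E}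
    (hΩ : Bornology.IsBounded Ω) (hA : ∀ p ∈ frontier A ∩ closure Ω, HasFlatBoundaryAt A p)
    (hnull : μH[finrank ℝ E - 1] (frontier A ∩ frontier Ω) = 0) (M : Set E) {c : ℝ} (hc : 1 < c) :
    limsup (fun r : ℝ => μH[finrank ℝ E - 1] (({x | infEDist x A = ENNReal.ofReal r} ∩ Ω) \
        {x | infEDist x M < ENNReal.ofReal (c * r)})) (𝓝[>] 0)
      ≤ μH[finrank ℝ E - 1] ((frontier A ∩ Ω) \ closure M) := by
  set S : ℝ≥0∞ := μH[finrank ℝ E - 1] ((frontier A ∩ Ω) \ closure M)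
  have hlim : Tendsto (fun K : ℝ≥0 => (K : ℝ≥0∞) ^ (finrank ℝ E - 1 : ℝ) * S) (𝓝[>] 1) (𝓝 S) := by
    have hpow : Continuous fun K : ℝ≥0 => (K : ℝ≥0∞) ^ (finrank ℝ E - 1 : ℝ) :=
      ENNReal.continuous_rpow_const.comp ENNReal.continuous_coe
    simpa using ENNReal.Tendsto.mul_const (b := S)
      ((hpow.tendsto 1).mono_left nhdsWithin_le_nhds) (Or.inl (by simp))
  refine ge_of_tendsto hlim ?_
  filter_upwards [self_mem_nhdsWithin] with K hK
  simpa only [farLevelSet, sdiff_inter_right_comm] using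
    limsup_farLevelSet_le_mul hΩ hA hnull M hc hK

theorem HasC1BoundaryIn.hasFlatBoundaryAt {d : ℕ} {A U : Set (EuclideanSpace ℝ (Fin d))}
    (hA : HasC1BoundaryIn A U) {p : EuclideanSpace ℝ (Fin d)} (hp : p ∈ frontier A ∩ U) :
    HasFlatBoundaryAt A p := by
  obtain ⟨V, φ, hVo, hpV, hφ, hφ', -, hneg, hpos⟩ := hA p hp
  have hV : V ∈ 𝓝 p := hVo.mem_nhds hpV
  exact hasFlatBoundaryAt_of_hasStrictFDerivAt
    ((hφ.contDiffAt hV).hasStrictFDerivAt one_ne_zero) (hφ' p hpV)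
    (mem_of_superset hV hneg) (mem_of_superset hV hpos)

theorem lemma6p2 {d : ℕ} (hd : 1 ≤ d)
    (Ω : Set (EuclideanSpace ℝ (Fin d))) (hΩo : IsOpen Ω) (hΩb : Bornology.IsBounded Ω)
    (A U : Set (EuclideanSpace ℝ (Fin d))) (hU : IsOpen U) (hΩU : closure Ω ⊆ U)
    (hA : HasC1BoundaryIn A U)
    (htrans : MeasureTheory.Measure.hausdorffMeasure ((d : ℝ) - 1)
      (frontier A ∩ frontier Ω) = 0)
    (M : Set (EuclideanSpace ℝ (Fin d))) (hM : M ⊆ Ω) :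
    Filter.limsup
      (fun r : ℝ => MeasureTheory.Measure.hausdorffMeasure ((d : ℝ) - 1)
        (({x | Metric.infEDist x A = ENNReal.ofReal r} ∩ Ω) \
          {x | Metric.infEDist x M < ENNReal.ofReal (3 * r)}))
      (nhdsWithin 0 (Set.Ioi 0))
    ≤ MeasureTheory.Measure.hausdorffMeasure ((d : ℝ) - 1) ((frontier A ∩ Ω) \ M) := by
  have : Nonempty (Fin d) := ⟨⟨0, hd⟩⟩
  refine le_trans ?_ (measure_mono (sdiff_subset_sdiff_right (subset_closure (s := M))))
  simpa only [finrank_euclideanSpace_fin] using lemma6p2_general hΩb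
    (fun p hp => hA.hasFlatBoundaryAt ⟨hp.1, hΩU hp.2⟩)
    (by simpa only [finrank_euclideanSpace_fin] using htrans) M (by norm_num : (1 : ℝ) < 3)
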